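/- Let $(X,d)$ be a proper metric space (closed bounded sets are compact; hence $X$ is complete and separable), let $A\subseteq X$ be closed and non-empty, and let $p\in[1,\infty)$. Write $\Omega=X\setminus A$, $E_\Omega=(X\times X)\setminus(A\times A)$, $d(x,A)=\inf_{a\in A}d(x,a)$, and $\pi^1,\pi^2$ for the coordinate projections. A (non-negative) Borel measure is Radon if it is finite on compact sets and inner regular with respect to compact sets. For measures $\mu,\nu$ on $\Omega$, let $\mathrm{Adm}(\mu,\nu)$ be the set of non-negative Borel measures $\gamma$ on $E_\Omega$ with $\pi^1_\#\gamma|_\Omega=\mu$ and $\pi^2_\#\gamma|_\Omega=\nu$; put \[ C(\gamma)=\int_{E_\Omega}d(x,y)^p\,d\gamma(x,y),\qquad \mathrm{Wb}_p(\mu,\nu)=\inf_{\gamma\in\mathrm{Adm}(\mu,\nu)}C(\gamma)^{1/p}, \] and $\mathrm{Opt}(\mu,\nu)=\{\gamma\in\mathrm{Adm}(\mu,\nu):C(\gamma)=\mathrm{Wb}_p(\mu,\nu)^p\}$. Let \[ c(x,y)=d(x,y)^p,\qquad \widetilde c(x,y)=\min\{d(x,y)^p,\ d(x,A)^p+d(y,A)^p\},\qquad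 \mathcal S=\{(x,y)\in X\times X:\widetilde c(x,y)=c(x,y)\}. \] A set $\Gamma\subseteq X\times X$ is $\widetilde c$-cyclically monotone if $\sum_{i=1}^n\widetilde c(x_i,y_i)\le\sum_{i=1}^n\widetilde c(x_i,y_{\sigma(i)})$ for all $n\in\mathbb N$, all $(x_1,y_1),\dots,(x_n,y_n)\in\Gamma$ and all permutations $\sigma$ of $\{1,\dots,n\}$. For $\phi\colon X\to\mathbb R\cup\{-\infty\}$ let $\phi^c(y)=\inf_{x\in X}\{c(x,y)-\phi(x)\}$; $\phi$ is $c$-concave if $\phi=\psi^c$ for some $\psi\colon X\to\mathbb R\cup\{-\infty\}$, and then $\partial^c_+\phi=\{(x,y)\in X\times X:c(x,y)=\phi(x)+\phi^c(y)\}$. The support $\mathrm{supp}(\gamma)\subseteq E_\Omega$ is the smallest relatively closed subset of $E_\Omega$ whose complement is $\gamma$-null. **Proposition.** Let $\gamma$ be a Radon measure on $E_\Omega$ with \[ \int_{E_\Omega}\bigl(d(x,A)^p+d(y,A)^p\bigr)\,d\gamma(x,y)<\infty . \] Then the following are equivalent: 1. $\gamma\in\mathrm{Opt}(\pi^1_\#\gamma|_\Omega,\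 \pi^2_\#\gamma|_\Omega)$; 2. $\gamma$ is concentrated on $\mathcal S$, i.e. $\gamma(E_\Omega\setminus\mathcal S)=0$, and the set $\mathrm{supp}(\gamma)\cup(A\times A)$ is $\widetilde c$-cyclically monotone; 3. there is a $c$-concave function $\phi\colon X\to\mathbb R\cup\{-\infty\}$ such that both $\phi$ and $\phi^c$ vanish on $A$ and $\mathrm{supp}(\gamma)\subseteq\partial^c_+\phi$. Moreover, if $\gamma\in\mathrm{Opt}(\pi^1_\#\gamma|_\Omega,\pi^2_\#\gamma|_\Omega)$, then $d(x,y)=d(x,A)$ for $\gamma|_{\Omega\times A}$-almost every $(x,y)$, and $d(x,y)=d(y,A)$ for $\gamma|_{A\times\Omega}$-almost every $(x,y)$. -/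

import Mathlib

open MeasureTheory
open scoped ENNReal

noncomputable section

namespace PartialOT

variable {X : Type*}

/-- A Radon measure: a nonnegative Borel measure that is finite on compact sets and inner regular
by compact sets on every Borel set. -/
def IsRadon {Y : Type*} [TopologicalSpace Y] [MeasurableSpace Y] (μ : Measure Y) : Prop :=
  IsFiniteMeasureOnCompacts μ ∧ μ.InnerRegular

/-- `Ω = X \ A`; measures on `Ω` are measures on the corresponding subtype. -/
def Omega (A : Set X) : Set X := Aᶜ

/-- `E_Ω = X × X \ A × A`; measures on `E_Ω` are measures on the corresponding subtype. -/
def EOmega (A : Set X) : Set (X × X) := (A ×ˢ A)ᶜ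

section Costs

variable [MetricSpace X]

/-- The cost `c(x, y) = d(x, y)^p`. -/
def cost (p : ℝ) (x y : X) : ℝ := dist x y ^ p

/-- The cost `c̃(x, y) = min {d(x, y)^p, d(x, A)^p + d(y, A)^p}`. -/
def costTilde (p : ℝ) (A : Set X) (x y : X) : ℝ :=
  min (dist x y ^ p) (Metric.infDist x A ^ p + Metric.infDist y A ^ p)

/-- The set `S` of pairs with `c̃(x, y) = c(x, y)`. -/
def setS (p : ℝ) (A : Set X) : Set (X × X) :=
  {z | costTilde p A z.1 z.2 = cost p z.1 z.2}

end Costs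

section Duality

/-- `c`-cyclical monotonicity of a set `Γ ⊆ X × X` for a cost `c`. -/
def CyclicallyMonotone (c : X → X → ℝ) (Γ : Set (X × X)) : Prop :=
  ∀ (n : ℕ) (x y : Fin n → X), (∀ i, (x i, y i) ∈ Γ) → ∀ σ : Equiv.Perm (Fin n),
    ∑ i, c (x i) (y i) ≤ ∑ i, c (x i) (y (σ i))

/-- The `c`-transform `φ^c(y) = inf_x (c(x, y) - φ(x))`. It is applied to functions with values in
`ℝ ∪ {-∞}`, that is, to `φ : X → EReal` that never take the value `⊤`. -/
def cTransform (c : X → X → ℝ) (φ : X → EReal) : X → EReal :=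
  fun y => ⨅ x, ((c x y : ℝ) : EReal) - φ x

/-- `φ : X → ℝ ∪ {-∞}` is `c`-concave if `φ = ψ^c` for some `ψ : X → ℝ ∪ {-∞}`. -/
def CConcave (c : X → X → ℝ) (φ : X → EReal) : Prop :=
  (∀ x, φ x ≠ ⊤) ∧ ∃ ψ : X → EReal, (∀ x, ψ x ≠ ⊤) ∧ φ = cTransform c ψ

/-- The `c`-superdifferential `∂^c_+ φ = {(x, y) : c(x, y) = φ(x) + φ^c(y)}`. -/
def cSuperdifferential (c : X → X → ℝ) (φ : X → EReal) : Set (X × X) :=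
  {z | ((c z.1 z.2 : ℝ) : EReal) = φ z.1 + cTransform c φ z.2}

end Duality

section Plans

variable [MetricSpace X] [MeasurableSpace X]

/-- The first marginal of a measure on `E_Ω`, restricted to `Ω`: `(π¹_# γ)|_Ω`. -/
def marginalFst (A : Set X) (γ : Measure (EOmega A)) : Measure (Omega A) :=
  (γ.map (fun z => z.1.1)).comap Subtype.val

/-- The second marginal of a measure on `E_Ω`, restricted to `Ω`: `(π²_# γ)|_Ω`. -/
def marginalSnd (A : Set X) (γ : Measure (EOmega A)) : Measure (Omega A) :=
  (γ.map (fun z => z.1.2)).comap Subtype.val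

/-- The set `Adm(μ, ν)` of partial transport plans between measures `μ`, `ν` on `Ω`. -/
def Adm (A : Set X) (μ ν : Measure (Omega A)) : Set (Measure (EOmega A)) :=
  {γ | marginalFst A γ = μ ∧ marginalSnd A γ = ν}

/-- The total cost `C(γ) = ∫ d(x, y)^p dγ(x, y) ∈ [0, ∞]`. -/
def totalCost (p : ℝ) (A : Set X) (γ : Measure (EOmega A)) : ℝ≥0∞ :=
  ∫⁻ z, ENNReal.ofReal (dist z.1.1 z.1.2 ^ p) ∂γ

/-- The partial transport distance `Wb_p(μ, ν) = inf_{γ ∈ Adm(μ, ν)} C(γ)^{1/p}`. -/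
def Wb (p : ℝ) (A : Set X) (μ ν : Measure (Omega A)) : ℝ≥0∞ :=
  ⨅ γ ∈ Adm A μ ν, totalCost p A γ ^ (1 / p)

/-- The set `Opt(μ, ν)` of optimal partial transport plans: the admissible `γ` with
`C(γ) = Wb_p(μ, ν)^p`. -/
def Opt (p : ℝ) (A : Set X) (μ ν : Measure (Omega A)) : Set (Measure (EOmega A)) :=
  {γ | γ ∈ Adm A μ ν ∧ totalCost p A γ = Wb p A μ ν ^ p}

/-- The support of a measure on `E_Ω`, as a subset of `X × X` contained in `E_Ω`. -/
def supp (A : Set X) (γ : Measure (EOmega A)) : Set (X × X) :=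
  Subtype.val '' γ.support

/-- The restriction `γ_R^S` of a measure on `E_Ω` to `R × S`. -/
def restrictTo {A : Set X} (γ : Measure (EOmega A)) (R S : Set X) : Measure (EOmega A) :=
  γ.restrict (Subtype.val ⁻¹' (R ×ˢ S))

/-- `γ` is concentrated on `T ⊆ X × X`: it gives no mass to `E_Ω \ T`. -/
def ConcentratedOn {A : Set X} (γ : Measure (EOmega A)) (T : Set (X × X)) : Prop :=
  γ (Subtype.val ⁻¹' Tᶜ) = 0

end Plans

end PartialOT

end

/-!
Optimality of a partial transport plan is compared with `c̃`-cyclical monotonicity of its support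
and with the existence of a potential that vanishes on `A`.

From monotonicity to a potential: Rockafellar's construction for `c̃`, based at a point of `A`
(`chainPotential`), gives a function that vanishes on `A` and lies below `d(·, A)^p`. For functions
of this kind `c` and `c̃` yield the same transform, because `d(x, A)^p = inf_{a ∈ A} c(x, a)`; so its
double transform for `c` is the required potential (`exists_cConcave_of_cyclicallyMonotone`).

From a potential to optimality: if `φ` and `φ^c` vanish on `A`, both lie below `d(·, A)^p`. The gaps
`u = d(·, A)^p - φ` and `v = d(·, A)^p - φ^c` are nonnegative and vanish on `A`, so the integrals of
`u(x)`, `v(y)` and `d(x, A)^p + d(y, A)^p` depend only on the marginals on `Ω`. Since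
`d(x, A)^p + d(y, A)^p ≤ c(x, y) + u(x) + v(y)`, with equality on the superdifferential, a plan
supported there has minimal cost (`mem_opt_of_supp_subset`).

From optimality to monotonicity: small pieces of the plan near points `(xᵢ, yᵢ)` of the support are
cut out and replaced by measures with the same marginals on `Ω` that join neighbourhoods of `xᵢ` and
`y_{σ(i)}`, either directly or by way of the nearest points of `A`, at a cost close to
`c̃(xᵢ, y_{σ(i)})`. Minimality gives `∑ c(xᵢ, yᵢ) ≤ ∑ c̃(xᵢ, y_{σ(i)})`
(`sum_cost_le_sum_costTilde`). A single pair yields `c = c̃` on the support, from which the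
statement about mass exchanged with `A` follows, and then the inequality is the cyclical
monotonicity. Subtracting costs requires an optimal plan to have finite cost, which follows from
comparison with a plan that sends everything approximately to the nearest points of `A`
(`totalCost_ne_top_of_mem_opt`).
-/

namespace PartialOT
open Filter
open scoped Topology

/-! ### Potentials of cyclically monotone sets -/

section Rockafellar

variable {X : Type*}

/-- Along a closed loop `x₀, …, xₙ = x₀` through `Γ`, re-pairing each `yᵢ` with the next point
`xᵢ₊₁` does not lower the cost. -/
theorem CyclicallyMonotone.sum_loop_nonneg {c : X → X → ℝ} {Γ : Set (X × X)}
    (h : CyclicallyMonotone c Γ) (n : ℕ) (x y : ℕ → X) (hΓ : ∀ i < n, (x i, y i) ∈ Γ)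
    (hloop : x n = x 0) :
    0 ≤ ∑ i ∈ Finset.range n, (c (x (i + 1)) (y i) - c (x i) (y i)) := by
  cases n with
  | zero => simp
  | succ m =>
    have key := h (m + 1) (fun i => x i) (fun i => y i) (fun i => hΓ i i.2) (finRotate (m + 1))⁻¹
    rw [← Equiv.sum_comp (finRotate (m + 1))
      (fun i => c (x i) (y ((finRotate (m + 1))⁻¹ i : Fin (m + 1))))] at key
    have hrot : ∀ i : Fin (m + 1), x (finRotate (m + 1) i : Fin (m + 1)) = x (i + 1) := by
      intro i
      rcases Fin.eq_castSucc_or_eq_last i with ⟨j, rfl⟩ | rfl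
      · simp
      · simp [hloop]
    simp only [Equiv.Perm.inv_def, Equiv.symm_apply_apply, hrot] at key
    rw [Finset.sum_sub_distrib, sub_nonneg, Finset.sum_range, Finset.sum_range]
    exact key

/-- The costs of all chains from `x₀` to `x` through `Γ`, each step from `xᵢ` to `xᵢ₊₁` through
`(xᵢ, yᵢ) ∈ Γ` costing `c (xᵢ₊₁, yᵢ) - c (xᵢ, yᵢ)`. -/
def chainCosts (c : X → X → ℝ) (Γ : Set (X × X)) (x₀ x : X) : Set ℝ :=
  {r | ∃ (n : ℕ) (xs ys : ℕ → X), xs 0 = x₀ ∧ xs n = x ∧ (∀ i < n, (xs i, ys i) ∈ Γ) ∧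
    r = ∑ i ∈ Finset.range n, (c (xs (i + 1)) (ys i) - c (xs i) (ys i))}

/-- Rockafellar's potential of `Γ` based at `x₀`: the infimum of the costs of all chains from `x₀`
to `x`. -/
noncomputable def chainPotential (c : X → X → ℝ) (Γ : Set (X × X)) (x₀ x : X) : EReal :=
  ⨅ r ∈ chainCosts c Γ x₀ x, (r : EReal)

theorem chainCosts_step {c : X → X → ℝ} {Γ : Set (X × X)} {x₀ x y : X} {r : ℝ}
    (hr : r ∈ chainCosts c Γ x₀ x) (hxy : (x, y) ∈ Γ) (x' : X) :
    r + (c x' y - c x y) ∈ chainCosts c Γ x₀ x' := by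
  obtain ⟨n, xs, ys, h0, hn, hΓ, rfl⟩ := hr
  have hx : ∀ i ≤ n, (if i ≤ n then xs i else x') = xs i := fun i hi => if_pos hi
  have hy : ∀ i < n, (if i < n then ys i else y) = ys i := fun i hi => if_pos hi
  refine ⟨n + 1, fun i => if i ≤ n then xs i else x', fun i => if i < n then ys i else y,
    ?_, ?_, ?_, ?_⟩
  · simpa using h0
  · simp
  · intro i hi
    rcases Nat.lt_succ_iff_lt_or_eq.1 hi with hi | rfl
    · simpa [hi, hi.le] using hΓ i hi
    · simpa [hn] using hxy
  · rw [Finset.sum_range_succ]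
    congr 1
    · refine Finset.sum_congr rfl fun i hi => ?_
      rw [Finset.mem_range] at hi
      simp only [hx i hi.le, hx (i + 1) hi, hy i hi]
    · simp [hn]

theorem chainPotential_le_add {c : X → X → ℝ} {Γ : Set (X × X)} {x₀ x y : X}
    (hxy : (x, y) ∈ Γ) (x' : X) :
    chainPotential c Γ x₀ x' ≤ chainPotential c Γ x₀ x + ((c x' y - c x y : ℝ) : EReal) := by
  have hbot := EReal.coe_ne_bot (c x' y - c x y)
  have htop := EReal.coe_ne_top (c x' y - c x y)
  rw [← EReal.sub_le_iff_le_add (Or.inl hbot) (Or.inl htop)]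
  refine le_iInf₂ fun r hr => ?_
  rw [EReal.sub_le_iff_le_add (Or.inl hbot) (Or.inl htop), ← EReal.coe_add]
  exact iInf₂_le _ (chainCosts_step hr hxy x')

theorem CyclicallyMonotone.chainPotential_self {c : X → X → ℝ} {Γ : Set (X × X)}
    (h : CyclicallyMonotone c Γ) (x₀ : X) : chainPotential c Γ x₀ x₀ = 0 := by
  apply le_antisymm
  · exact iInf₂_le (0 : ℝ) ⟨0, fun _ => x₀, fun _ => x₀, rfl, rfl, by simp, by simp⟩
  · refine le_iInf₂ fun r hr => ?_
    obtain ⟨n, xs, ys, h0, hn, hΓ, rfl⟩ := hr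
    exact_mod_cast h.sum_loop_nonneg n xs ys hΓ (hn.trans h0.symm)

end Rockafellar

/-! ### The costs `c` and `c̃` -/

section Costs

variable {X : Type*} [MetricSpace X] {p : ℝ} {A : Set X}

theorem cost_nonneg (x y : X) : 0 ≤ cost p x y := Real.rpow_nonneg dist_nonneg _

theorem cost_comm (x y : X) : cost p x y = cost p y x := by simp [cost, dist_comm]

theorem cost_self (hp : 0 < p) (x : X) : cost p x x = 0 := by
  simp [cost, Real.zero_rpow hp.ne']

theorem continuous_cost (hp : 0 ≤ p) : Continuous fun z : X × X => cost p z.1 z.2 :=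
  (continuous_fst.dist continuous_snd).rpow_const fun _ => Or.inr hp

theorem infDist_rpow_le_cost (hp : 0 ≤ p) {a : X} (ha : a ∈ A) (x : X) :
    Metric.infDist x A ^ p ≤ cost p x a :=
  Real.rpow_le_rpow Metric.infDist_nonneg (Metric.infDist_le_dist_of_mem ha) hp

theorem infDist_rpow_nonneg (x : X) : 0 ≤ Metric.infDist x A ^ p :=
  Real.rpow_nonneg Metric.infDist_nonneg _

theorem infDist_rpow_eq_zero (hp : 0 < p) {a : X} (ha : a ∈ A) : Metric.infDist a A ^ p = 0 := by
  rw [Metric.infDist_zero_of_mem ha, Real.zero_rpow hp.ne']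

theorem continuous_infDist_rpow (hp : 0 ≤ p) : Continuous fun x : X => Metric.infDist x A ^ p :=
  (Metric.continuous_infDist_pt A).rpow_const fun _ => Or.inr hp

theorem costTilde_nonneg (x y : X) : 0 ≤ costTilde p A x y :=
  le_min (cost_nonneg x y) (add_nonneg (infDist_rpow_nonneg x) (infDist_rpow_nonneg y))

theorem costTilde_le_cost (x y : X) : costTilde p A x y ≤ cost p x y := min_le_left _ _

theorem costTilde_eq_of_right_mem (hp : 0 < p) {a : X} (ha : a ∈ A) (x : X) :
    costTilde p A x a = Metric.infDist x A ^ p := by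
  rw [costTilde, infDist_rpow_eq_zero hp ha, add_zero]
  exact min_eq_right (infDist_rpow_le_cost hp.le ha x)

theorem costTilde_eq_zero (hp : 0 < p) {a b : X} (ha : a ∈ A) (hb : b ∈ A) :
    costTilde p A a b = 0 := by
  rw [costTilde_eq_of_right_mem hp hb, infDist_rpow_eq_zero hp ha]

theorem dist_eq_infDist_of_mem_setS_right (hp : 0 < p) {x a : X} (ha : a ∈ A)
    (h : (x, a) ∈ setS p A) : dist x a = Metric.infDist x A := by
  have h' : costTilde p A x a = cost p x a := h
  rw [costTilde_eq_of_right_mem hp ha, cost] at h'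
  exact ((Real.rpow_left_inj Metric.infDist_nonneg dist_nonneg hp.ne').1 h').symm

theorem costTilde_comm (x y : X) : costTilde p A x y = costTilde p A y x := by
  simp [costTilde, dist_comm, add_comm]

theorem swap_mem_setS {x y : X} (h : (x, y) ∈ setS p A) : (y, x) ∈ setS p A := by
  have h' : costTilde p A x y = cost p x y := h
  change costTilde p A y x = cost p y x
  rw [costTilde_comm, h', cost_comm]

theorem isClosed_setS (hp : 0 ≤ p) : IsClosed (setS p A) := by
  have hc : Continuous fun z : X × X => cost p z.1 z.2 := continuous_cost hp
  have hd : Continuous fun x : X => Metric.infDist x A ^ p := continuous_infDist_rpow hp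
  exact isClosed_eq (hc.min ((hd.comp continuous_fst).add (hd.comp continuous_snd))) hc

theorem exists_ball_abs_cost_sub_lt (hp : 0 ≤ p) (u w : X) {δ : ℝ} (hδ : 0 < δ) :
    ∃ r > 0, ∀ x ∈ Metric.ball u r, ∀ y ∈ Metric.ball w r, |cost p x y - cost p u w| < δ := by
  obtain ⟨r, hr, h⟩ := Metric.continuousAt_iff.1
    ((continuous_cost hp).continuousAt (x := (u, w))) δ hδ
  exact ⟨r, hr, fun x hx y hy => h (x := (x, y)) (max_lt hx hy)⟩

end Costs

/-! ### From cyclical monotonicity to a potential vanishing on `A` -/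

section Potential

variable {X : Type*}

theorem cTransform_le (c : X → X → ℝ) (φ : X → EReal) (x y : X) :
    cTransform c φ y ≤ (c x y : EReal) - φ x := iInf_le _ x

/-- The double transform of a function lies above it. -/
theorem le_cTransform_cTransform {c : X → X → ℝ} (hc : ∀ x y, c x y = c y x) (φ : X → EReal)
    (x : X) : φ x ≤ cTransform c (cTransform c φ) x := by
  refine le_iInf fun y => ?_
  have h := cTransform_le c φ x y
  rw [hc y x]
  rw [EReal.le_sub_iff_add_le (by simp) (by simp)] at h ⊢
  rwa [add_comm]

theorem cTransform_anti {c : X → X → ℝ} {φ ψ : X → EReal} (h : φ ≤ ψ) :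
    cTransform c ψ ≤ cTransform c φ :=
  fun _ => iInf_mono fun x => EReal.sub_le_sub le_rfl (h x)

theorem cTransform_cTransform_cTransform {c : X → X → ℝ} (hc : ∀ x y, c x y = c y x)
    (φ : X → EReal) : cTransform c (cTransform c (cTransform c φ)) = cTransform c φ :=
  le_antisymm (cTransform_anti (le_cTransform_cTransform hc φ))
    (le_cTransform_cTransform hc (cTransform c φ))

variable [MetricSpace X] {p : ℝ} {A : Set X}

/-- If `φ` vanishes on `A` and `φ ≤ d(·, A)^p`, then so does `φ^c`. -/
theorem cTransform_eq_zero_of_mem (hp : 0 < p) {φ : X → EReal} (h0 : ∀ a ∈ A, φ a = 0)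
    (hle : ∀ x, φ x ≤ ((Metric.infDist x A ^ p : ℝ) : EReal)) {a : X} (ha : a ∈ A) :
    cTransform (cost p) φ a = 0 := by
  apply le_antisymm
  · have := cTransform_le (cost p) φ a a
    simpa [h0 a ha, cost_self hp] using this
  · refine le_iInf fun x => ?_
    rw [EReal.le_sub_iff_add_le (by simp) (by simp), zero_add]
    exact (hle x).trans (by exact_mod_cast infDist_rpow_le_cost hp.le ha x)

theorem cTransform_le_infDist [ProperSpace X] (hA : IsClosed A) (hA' : A.Nonempty)
    {φ : X → EReal} (h0 : ∀ a ∈ A, φ a = 0) (y : X) :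
    cTransform (cost p) φ y ≤ ((Metric.infDist y A ^ p : ℝ) : EReal) := by
  obtain ⟨a, ha, hd⟩ := hA.exists_infDist_eq_dist hA' y
  have := cTransform_le (cost p) φ a y
  rw [h0 a ha, sub_zero] at this
  rwa [hd, dist_comm]

/-- A subset `Γ` of `S` whose union with `A × A` is `c̃`-cyclically monotone lies in the
superdifferential of a `c`-concave function that vanishes on `A` together with its transform. The
chain potential for `c̃` based at a point of `A` is only an intermediate: its double transform for
the cost `c` is the required function. -/
theorem exists_cConcave_of_cyclicallyMonotone [ProperSpace X] (hA : IsClosed A)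
    (hA' : A.Nonempty) (hp : 0 < p) {Γ : Set (X × X)} (hS : Γ ⊆ setS p A)
    (hΓ : CyclicallyMonotone (costTilde p A) (Γ ∪ A ×ˢ A)) :
    ∃ φ : X → EReal, CConcave (cost p) φ ∧
      (∀ a ∈ A, φ a = 0 ∧ cTransform (cost p) φ a = 0) ∧
      Γ ⊆ cSuperdifferential (cost p) φ := by
  obtain ⟨a₀, ha₀⟩ := hA'
  have hAA : ∀ a ∈ A, (a, a) ∈ Γ ∪ A ×ˢ A := fun a ha => Or.inr ⟨ha, ha⟩
  set f : X → EReal := chainPotential (costTilde p A) (Γ ∪ A ×ˢ A) a₀ with hf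
  have hf₀ : f a₀ = 0 := hΓ.chainPotential_self a₀
  have hfle : ∀ x, f x ≤ ((Metric.infDist x A ^ p : ℝ) : EReal) := by
    intro x
    have := chainPotential_le_add (c := costTilde p A) (x₀ := a₀) (hAA a₀ ha₀) x
    rwa [← hf, hf₀, zero_add, costTilde_eq_zero hp ha₀ ha₀, sub_zero,
      costTilde_eq_of_right_mem hp ha₀] at this
  have hfA : ∀ a ∈ A, f a = 0 := by
    intro a ha
    apply le_antisymm
    · simpa [infDist_rpow_eq_zero hp ha] using hfle a
    · have := chainPotential_le_add (c := costTilde p A) (x₀ := a₀) (hAA a ha) a₀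
      rwa [← hf, hf₀, costTilde_eq_zero hp ha₀ ha, costTilde_eq_zero hp ha ha, sub_zero,
        EReal.coe_zero, add_zero] at this
  -- From here on the transforms are those of `c`, not of `c̃`.
  set g : X → EReal := cTransform (cost p) f with hg
  have hgA : ∀ a ∈ A, g a = 0 := fun a ha => cTransform_eq_zero_of_mem hp hfA hfle ha
  have hgle := cTransform_le_infDist (p := p) hA ⟨a₀, ha₀⟩ hfA
  have hhle := cTransform_le_infDist (p := p) hA ⟨a₀, ha₀⟩ hgA
  have hgg : cTransform (cost p) (cTransform (cost p) g) = g :=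
    cTransform_cTransform_cTransform cost_comm f
  refine ⟨cTransform (cost p) g, ⟨fun x => ((hhle x).trans_lt (EReal.coe_lt_top _)).ne,
    g, fun x => ((hgle x).trans_lt (EReal.coe_lt_top _)).ne, rfl⟩, fun a ha => ⟨?_, ?_⟩, ?_⟩
  · exact cTransform_eq_zero_of_mem hp hgA hgle ha
  · rw [hgg, hgA a ha]
  · rintro ⟨x, y⟩ hxy
    have hc : costTilde p A x y = cost p x y := hS hxy
    have hstep : ∀ x', f x' ≤ f x + ((costTilde p A x' y - costTilde p A x y : ℝ) : EReal) :=
      chainPotential_le_add (Or.inl hxy)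
    have hbot : f x ≠ ⊥ := by
      intro hb
      have := hstep a₀
      rw [hb, hf₀, EReal.bot_add] at this
      simp at this
    have htop : f x ≠ ⊤ := ((hfle x).trans_lt (EReal.coe_lt_top _)).ne
    obtain ⟨t, ht⟩ : ∃ t : ℝ, f x = t := ⟨(f x).toReal, (EReal.coe_toReal htop hbot).symm⟩
    have hgy : g y = ((cost p x y - t : ℝ) : EReal) := by
      apply le_antisymm
      · have := cTransform_le (cost p) f x y
        rwa [ht, ← EReal.coe_sub] at this
      · refine le_iInf fun x' => ?_
        rw [EReal.le_sub_iff_add_le (by simp) (by simp)]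
        refine (add_le_add_right (hstep x') _).trans ?_
        rw [ht, ← EReal.coe_add, ← EReal.coe_add, EReal.coe_le_coe_iff, hc]
        linarith [costTilde_le_cost (p := p) (A := A) x' y]
    have hhx : cTransform (cost p) g x = t := by
      apply le_antisymm
      · have := cTransform_le (cost p) g y x
        rwa [hgy, ← EReal.coe_sub, cost_comm y x, sub_sub_cancel] at this
      · rw [← ht]
        exact le_cTransform_cTransform cost_comm f x
    change (_ : EReal) = cTransform (cost p) g x + cTransform (cost p) (cTransform (cost p) g) y
    rw [hgg, hgy, hhx, ← EReal.coe_add, add_sub_cancel]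

end Potential

/-! ### Gaps between potentials and the distance to `A` -/

section Gap

variable {X : Type*} [MetricSpace X] {p : ℝ} {A : Set X} {φ ψ : X → EReal}

/-- The cost `c` as an extended nonnegative function on `X × X`. -/
noncomputable def ecost (p : ℝ) (z : X × X) : ℝ≥0∞ := ENNReal.ofReal (cost p z.1 z.2)

/-- The distance to `A` to the power `p`, as an extended nonnegative function. -/
noncomputable def einfDist (p : ℝ) (A : Set X) (x : X) : ℝ≥0∞ :=
  ENNReal.ofReal (Metric.infDist x A ^ p)

theorem einfDist_eq_zero (hp : 0 < p) {a : X} (ha : a ∈ A) : einfDist p A a = 0 := by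
  simp [einfDist, infDist_rpow_eq_zero hp ha]

theorem ofReal_infDist_add (x y : X) :
    ENNReal.ofReal (Metric.infDist x A ^ p + Metric.infDist y A ^ p) =
      einfDist p A x + einfDist p A y :=
  ENNReal.ofReal_add (infDist_rpow_nonneg x) (infDist_rpow_nonneg y)

/-- The gap `d(·, A)^p - φ`, for a function `φ ≤ d(·, A)^p`. It is infinite where `φ = -∞`, and
truncated to `0` where `φ > d(·, A)^p`. -/
noncomputable def gap (p : ℝ) (A : Set X) (φ : X → EReal) (x : X) : ℝ≥0∞ :=
  (((Metric.infDist x A ^ p : ℝ) : EReal) - φ x).toENNReal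

theorem gap_eq_zero (hp : 0 < p) {φ : X → EReal} {a : X} (ha : a ∈ A) (h : φ a = 0) :
    gap p A φ a = 0 := by
  simp [gap, h, infDist_rpow_eq_zero hp ha]

theorem gap_of_coe {φ : X → EReal} {x : X} {t : ℝ} (h : φ x = t) :
    gap p A φ x = ENNReal.ofReal (Metric.infDist x A ^ p - t) := by
  rw [gap, h, ← EReal.coe_sub, EReal.toENNReal_of_ne_top (EReal.coe_ne_top _), EReal.toReal_coe]

theorem gap_of_bot {φ : X → EReal} {x : X} (h : φ x = ⊥) : gap p A φ x = ⊤ := by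
  simp [gap, h]

/-- A pair of potentials with `φ(x) + ψ(y) ≤ c(x, y)`, read as a lower bound of the cost of sending
`x` and `y` to `A`. -/
theorem einfDist_add_le_ecost_add_gap {x y : X} (hφ : φ x ≠ ⊤) (hψ : ψ y ≠ ⊤)
    (h : φ x + ψ y ≤ (cost p x y : EReal)) :
    einfDist p A x + einfDist p A y ≤ ecost p (x, y) + gap p A φ x + gap p A ψ y := by
  induction hx : φ x with
  | bot => simp [gap_of_bot hx]
  | top => exact absurd hx hφ
  | coe s =>
    induction hy : ψ y with
    | bot => simp [gap_of_bot hy]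
    | top => exact absurd hy hψ
    | coe t =>
      rw [gap_of_coe hx, gap_of_coe hy, ← ofReal_infDist_add, ecost]
      rw [hx, hy, ← EReal.coe_add, EReal.coe_le_coe_iff] at h
      refine le_trans (ENNReal.ofReal_le_ofReal ?_)
        (ENNReal.ofReal_add_le.trans (add_le_add_left ENNReal.ofReal_add_le _))
      linarith

/-- Equality holds in the bound where `φ(x) + ψ(y) = c(x, y)`. -/
theorem ecost_add_gap_eq {x y : X}
    (hφ : φ x ≤ ((Metric.infDist x A ^ p : ℝ) : EReal))
    (hψ : ψ y ≤ ((Metric.infDist y A ^ p : ℝ) : EReal))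
    (h : (cost p x y : EReal) = φ x + ψ y) :
    ecost p (x, y) + gap p A φ x + gap p A ψ y = einfDist p A x + einfDist p A y := by
  induction hx : φ x with
  | bot => simp [hx] at h
  | top => simp [hx] at hφ
  | coe s =>
    induction hy : ψ y with
    | bot => simp [hy] at h
    | top => simp [hy] at hψ
    | coe t =>
      rw [gap_of_coe hx, gap_of_coe hy, ← ofReal_infDist_add, ecost]
      rw [hx, hy, ← EReal.coe_add, EReal.coe_eq_coe_iff] at h
      rw [hx, EReal.coe_le_coe_iff] at hφ
      rw [hy, EReal.coe_le_coe_iff] at hψ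
      rw [← ENNReal.ofReal_add (cost_nonneg x y) (sub_nonneg.2 hφ),
        ← ENNReal.ofReal_add (add_nonneg (cost_nonneg x y) (sub_nonneg.2 hφ)) (sub_nonneg.2 hψ)]
      congr 1
      linarith

end Gap

/-! ### Marginals and optimality of plans -/

section

variable {X : Type*} [MeasurableSpace X] {A : Set X}

theorem measurable_fst_EOmega : Measurable fun z : EOmega A => z.1.1 :=
  measurable_fst.comp measurable_subtype_coe

theorem measurable_snd_EOmega : Measurable fun z : EOmega A => z.1.2 :=
  measurable_snd.comp measurable_subtype_coe

end

section Plans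

variable {X : Type*} [MetricSpace X] [MeasurableSpace X] {p : ℝ} {A : Set X}

theorem totalCost_add (γ γ' : Measure (EOmega A)) :
    totalCost p A (γ + γ') = totalCost p A γ + totalCost p A γ' := lintegral_add_measure _ _ _

/-- A plan is optimal iff its cost is minimal among the plans with the same marginals. -/
theorem mem_opt_iff (hp : 0 < p) {μ ν : Measure (Omega A)} {γ : Measure (EOmega A)} :
    γ ∈ Opt p A μ ν ↔
      γ ∈ Adm A μ ν ∧ ∀ γ' ∈ Adm A μ ν, totalCost p A γ ≤ totalCost p A γ' := by
  have hroot : ∀ t : ℝ≥0∞, (t ^ (1 / p)) ^ p = t := fun t => by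
    rw [← ENNReal.rpow_mul, one_div, inv_mul_cancel₀ hp.ne', ENNReal.rpow_one]
  refine and_congr_right fun hγ => ⟨fun h γ' hγ' => ?_, fun h => le_antisymm ?_ ?_⟩
  · rw [h, ← hroot (totalCost p A γ')]
    exact ENNReal.rpow_le_rpow (iInf₂_le γ' hγ') hp.le
  · rw [← hroot (totalCost p A γ)]
    refine ENNReal.rpow_le_rpow (le_iInf₂ fun γ' hγ' => ?_) hp.le
    exact ENNReal.rpow_le_rpow (h γ' hγ') (one_div_pos.2 hp).le
  · conv_rhs => rw [← hroot (totalCost p A γ)]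
    exact ENNReal.rpow_le_rpow (iInf₂_le γ hγ) hp.le

variable [BorelSpace X]

theorem measurableSet_Omega (hA : IsClosed A) : MeasurableSet (Omega A) :=
  hA.measurableSet.compl

theorem measurableSet_EOmega (hA : IsClosed A) : MeasurableSet (EOmega A) :=
  (hA.measurableSet.prod hA.measurableSet).compl

theorem marginalFst_apply (hA : IsClosed A) (γ : Measure (EOmega A)) {s : Set (Omega A)}
    (hs : MeasurableSet s) :
    marginalFst A γ s = γ ((fun z => z.1.1) ⁻¹' (Subtype.val '' s)) := by
  have hemb := MeasurableEmbedding.subtype_coe (measurableSet_Omega hA)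
  rw [marginalFst, hemb.comap_apply,
    Measure.map_apply measurable_fst_EOmega (hemb.measurableSet_image.2 hs)]

theorem marginalSnd_apply (hA : IsClosed A) (γ : Measure (EOmega A)) {s : Set (Omega A)}
    (hs : MeasurableSet s) :
    marginalSnd A γ s = γ ((fun z => z.1.2) ⁻¹' (Subtype.val '' s)) := by
  have hemb := MeasurableEmbedding.subtype_coe (measurableSet_Omega hA)
  rw [marginalSnd, hemb.comap_apply,
    Measure.map_apply measurable_snd_EOmega (hemb.measurableSet_image.2 hs)]

/-- A function of the first coordinate that vanishes on `A` has an integral that depends only on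
the marginal on `Ω`. -/
theorem lintegral_fst_eq (hA : IsClosed A) (γ : Measure (EOmega A)) {f : X → ℝ≥0∞}
    (hf : Measurable f) (h0 : ∀ a ∈ A, f a = 0) :
    ∫⁻ z, f z.1.1 ∂γ = ∫⁻ x : Omega A, f x ∂(marginalFst A γ) := by
  rw [marginalFst, lintegral_subtype_comap (measurableSet_Omega hA),
    setLIntegral_eq_of_support_subset, lintegral_map hf measurable_fst_EOmega]
  exact fun x hx hxA => hx (h0 x hxA)

theorem lintegral_snd_eq (hA : IsClosed A) (γ : Measure (EOmega A)) {f : X → ℝ≥0∞}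
    (hf : Measurable f) (h0 : ∀ a ∈ A, f a = 0) :
    ∫⁻ z, f z.1.2 ∂γ = ∫⁻ x : Omega A, f x ∂(marginalSnd A γ) := by
  rw [marginalSnd, lintegral_subtype_comap (measurableSet_Omega hA),
    setLIntegral_eq_of_support_subset, lintegral_map hf measurable_snd_EOmega]
  exact fun x hx hxA => hx (h0 x hxA)

theorem measurable_einfDist (hp : 0 ≤ p) : Measurable (einfDist p A) :=
  (continuous_infDist_rpow hp).measurable.ennreal_ofReal

section Potential

theorem measurable_cTransform {c : X → X → ℝ} (hc : ∀ x, Continuous (c x)) (φ : X → EReal) :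
    Measurable (cTransform c φ) := by
  apply UpperSemicontinuous.measurable
  apply upperSemicontinuous_iInf
  intro x
  apply Continuous.upperSemicontinuous
  induction hφ : φ x with
  | bot => simpa [EReal.sub_bot] using continuous_const
  | top => simpa [EReal.sub_top] using continuous_const
  | coe t =>
    simp only [← EReal.coe_sub]
    exact continuous_coe_real_ereal.comp ((hc x).sub continuous_const)

theorem measurable_gap (hp : 0 ≤ p) {φ : X → EReal} (hφ : Measurable φ) :
    Measurable (gap p A φ) :=
  ((continuous_infDist_rpow hp).measurable.coe_real_ereal.sub hφ).ereal_toENNReal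

variable [ProperSpace X] {φ : X → EReal}

/-- A plan supported in the superdifferential of a potential vanishing on `A` is optimal. Both
`φ` and `φ^c` are replaced by their gaps to `d(·, A)^p`: these are nonnegative, vanish on `A`, and
so have the same integral for all plans with the same marginals. -/
theorem mem_opt_of_supp_subset (hA : IsClosed A) (hA' : A.Nonempty) (hp : 0 < p)
    {γ : Measure (EOmega A)} (hfin : ∫⁻ z, (einfDist p A z.1.1 + einfDist p A z.1.2) ∂γ ≠ ⊤)
    (hφ : CConcave (cost p) φ)
    (h0 : ∀ a ∈ A, φ a = 0 ∧ cTransform (cost p) φ a = 0)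
    (hsupp : supp A γ ⊆ cSuperdifferential (cost p) φ) :
    γ ∈ Opt p A (marginalFst A γ) (marginalSnd A γ) := by
  have hcont : ∀ x : X, Continuous (cost p x) := fun x =>
    (continuous_cost hp.le).comp (by fun_prop : Continuous fun y => (x, y))
  set ψ := cTransform (cost p) φ with hψ
  have hsum : ∀ x y, φ x + ψ y ≤ (cost p x y : EReal) := by
    intro x y
    by_cases hx : φ x = ⊥
    · simp [hx]
    · rw [add_comm, ← EReal.le_sub_iff_add_le (Or.inl hx) (Or.inl (hφ.1 x))]
      exact cTransform_le _ _ _ _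
  have hψle := cTransform_le_infDist (p := p) hA hA' fun a ha => (h0 a ha).1
  have hφle : ∀ x, φ x ≤ ((Metric.infDist x A ^ p : ℝ) : EReal) := fun x =>
    (le_cTransform_cTransform cost_comm φ x).trans
      (cTransform_le_infDist hA hA' (fun a ha => (h0 a ha).2) x)
  have hφm : Measurable φ := by
    obtain ⟨-, χ, -, rfl⟩ := hφ
    exact measurable_cTransform hcont χ
  have hu := measurable_gap (A := A) hp.le hφm
  have hv := measurable_gap (A := A) hp.le (measurable_cTransform hcont φ)
  have hu0 : ∀ a ∈ A, gap p A φ a = 0 := fun a ha => gap_eq_zero hp ha (h0 a ha).1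
  have hv0 : ∀ a ∈ A, gap p A ψ a = 0 := fun a ha => gap_eq_zero hp ha (h0 a ha).2
  have hd := measurable_einfDist (A := A) hp.le
  have hsplit : ∀ η : Measure (EOmega A),
      ∫⁻ z, (ecost p z.1 + gap p A φ z.1.1 + gap p A ψ z.1.2) ∂η =
        totalCost p A η + (∫⁻ x : Omega A, gap p A φ x ∂(marginalFst A η) +
          ∫⁻ y : Omega A, gap p A ψ y ∂(marginalSnd A η)) := by
    intro η
    have hu' : Measurable fun z : EOmega A => gap p A φ z.1.1 := hu.comp measurable_fst_EOmega
    have hv' : Measurable fun z : EOmega A => gap p A ψ z.1.2 := hv.comp measurable_snd_EOmega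
    rw [lintegral_add_right _ hv', lintegral_add_right _ hu',
      lintegral_fst_eq hA η hu hu0, lintegral_snd_eq hA η hv hv0, add_assoc]
    rfl
  have hsplitD : ∀ η : Measure (EOmega A),
      ∫⁻ z, (einfDist p A z.1.1 + einfDist p A z.1.2) ∂η =
        ∫⁻ x : Omega A, einfDist p A x ∂(marginalFst A η) +
          ∫⁻ y : Omega A, einfDist p A y ∂(marginalSnd A η) := by
    intro η
    have hd' : Measurable fun z : EOmega A => einfDist p A z.1.2 := hd.comp measurable_snd_EOmega
    rw [lintegral_add_right _ hd', lintegral_fst_eq hA η hd fun a => einfDist_eq_zero hp,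
      lintegral_snd_eq hA η hd fun a => einfDist_eq_zero hp]
  refine (mem_opt_iff hp).2 ⟨⟨rfl, rfl⟩, fun γ' hγ' => ?_⟩
  have hEq : ∫⁻ z, (ecost p z.1 + gap p A φ z.1.1 + gap p A ψ z.1.2) ∂γ =
      ∫⁻ z, (einfDist p A z.1.1 + einfDist p A z.1.2) ∂γ := by
    apply lintegral_congr_ae
    filter_upwards [Measure.support_mem_ae (μ := γ)] with z hz
    exact ecost_add_gap_eq (hφle _) (hψle _) (hsupp ⟨z, hz, rfl⟩)
  have hLe : ∫⁻ z, (einfDist p A z.1.1 + einfDist p A z.1.2) ∂γ' ≤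
      ∫⁻ z, (ecost p z.1 + gap p A φ z.1.1 + gap p A ψ z.1.2) ∂γ' :=
    lintegral_mono fun z => einfDist_add_le_ecost_add_gap (hφ.1 _)
      ((hψle _).trans_lt (EReal.coe_lt_top _)).ne (hsum _ _)
  have hfin' := hfin
  rw [← hEq, hsplit] at hfin'
  rw [hsplitD, hsplit, hγ'.1, hγ'.2, ← hsplitD, ← hEq, hsplit] at hLe
  exact (ENNReal.add_le_add_iff_right (ENNReal.add_ne_top.1 hfin').2).1 hLe

end Potential

end Plans

/-! ### Exchanging part of a plan -/

section Exchange

variable {X : Type*} [MeasurableSpace X] {A : Set X}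

/-- A measure `π` on `X × X` whose marginals agree with `μ` and `ν` away from `A`. The mass that
`π` carries on `A × A` is irrelevant. -/
structure IsPartialCoupling (A : Set X) (π : Measure (X × X)) (μ ν : Measure X) : Prop where
  fst_apply : ∀ T, MeasurableSet T → Disjoint T A → π (Prod.fst ⁻¹' T) = μ T
  snd_apply : ∀ T, MeasurableSet T → Disjoint T A → π (Prod.snd ⁻¹' T) = ν T

theorem IsPartialCoupling.smul {π : Measure (X × X)} {μ ν : Measure X}
    (h : IsPartialCoupling A π μ ν) (t : ℝ≥0∞) : IsPartialCoupling A (t • π) (t • μ) (t • ν) where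
  fst_apply T hT hTA := by simp [h.fst_apply T hT hTA]
  snd_apply T hT hTA := by simp [h.snd_apply T hT hTA]

theorem IsPartialCoupling.sum {ι : Type*} [Fintype ι] {π : ι → Measure (X × X)}
    {μ ν : ι → Measure X} (h : ∀ i, IsPartialCoupling A (π i) (μ i) (ν i)) :
    IsPartialCoupling A (∑ i, π i) (∑ i, μ i) (∑ i, ν i) where
  fst_apply T hT hTA := by
    simp only [Measure.finsetSum_apply]
    exact Finset.sum_congr rfl fun i _ => (h i).fst_apply T hT hTA
  snd_apply T hT hTA := by
    simp only [Measure.finsetSum_apply]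
    exact Finset.sum_congr rfl fun i _ => (h i).snd_apply T hT hTA

/-- The plan on `E_Ω` obtained from a measure on `X × X` by discarding the mass on `A × A`. -/
noncomputable def ofProd (A : Set X) (π : Measure (X × X)) : Measure (EOmega A) :=
  π.comap Subtype.val

variable [MetricSpace X] [BorelSpace X] {p : ℝ}

theorem ofProd_map_val (hA : IsClosed A) (κ : Measure (EOmega A)) :
    ofProd A (κ.map Subtype.val) = κ :=
  (MeasurableEmbedding.subtype_coe (measurableSet_EOmega hA)).comap_map κ

theorem IsPartialCoupling.marginalFst_ofProd (hA : IsClosed A) {π : Measure (X × X)}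
    {μ ν : Measure X} (h : IsPartialCoupling A π μ ν) :
    marginalFst A (ofProd A π) = μ.comap Subtype.val := by
  have hemb := MeasurableEmbedding.subtype_coe (measurableSet_Omega hA)
  ext s hs
  have hT := hemb.measurableSet_image.2 hs
  have hTA : ∀ x ∈ (Subtype.val '' s : Set X), x ∉ A := by rintro _ ⟨x, -, rfl⟩; exact x.2
  rw [marginalFst_apply hA _ hs, hemb.comap_apply,
    ← h.fst_apply _ hT (Set.disjoint_left.2 hTA), ofProd,
    (MeasurableEmbedding.subtype_coe (measurableSet_EOmega hA)).comap_apply]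
  congr 1
  ext z
  refine ⟨?_, fun hz => ⟨⟨z, fun hzA => hTA _ hz hzA.1⟩, hz, rfl⟩⟩
  rintro ⟨z, hz, rfl⟩
  exact hz

theorem IsPartialCoupling.marginalSnd_ofProd (hA : IsClosed A) {π : Measure (X × X)}
    {μ ν : Measure X} (h : IsPartialCoupling A π μ ν) :
    marginalSnd A (ofProd A π) = ν.comap Subtype.val := by
  have hemb := MeasurableEmbedding.subtype_coe (measurableSet_Omega hA)
  ext s hs
  have hT := hemb.measurableSet_image.2 hs
  have hTA : ∀ x ∈ (Subtype.val '' s : Set X), x ∉ A := by rintro _ ⟨x, -, rfl⟩; exact x.2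
  rw [marginalSnd_apply hA _ hs, hemb.comap_apply,
    ← h.snd_apply _ hT (Set.disjoint_left.2 hTA), ofProd,
    (MeasurableEmbedding.subtype_coe (measurableSet_EOmega hA)).comap_apply]
  congr 1
  ext z
  refine ⟨?_, fun hz => ⟨⟨z, fun hzA => hTA _ hz hzA.2⟩, hz, rfl⟩⟩
  rintro ⟨z, hz, rfl⟩
  exact hz

theorem totalCost_ofProd_le (hA : IsClosed A) (π : Measure (X × X)) :
    totalCost p A (ofProd A π) ≤ ∫⁻ z, ecost p z ∂π :=
  (lintegral_subtype_comap (measurableSet_EOmega hA) (ecost p)).trans_le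
    (setLIntegral_le_lintegral _ _)

theorem marginalFst_add (hA : IsClosed A) (γ γ' : Measure (EOmega A)) :
    marginalFst A (γ + γ') = marginalFst A γ + marginalFst A γ' := by
  ext s hs
  simp only [Measure.add_apply, marginalFst_apply hA _ hs]

theorem marginalSnd_add (hA : IsClosed A) (γ γ' : Measure (EOmega A)) :
    marginalSnd A (γ + γ') = marginalSnd A γ + marginalSnd A γ' := by
  ext s hs
  simp only [Measure.add_apply, marginalSnd_apply hA _ hs]

/-- A finite part of an optimal plan of finite cost is no more expensive than any measure on
`X × X` with the same marginals away from `A`. -/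
theorem totalCost_le_of_mem_opt (hA : IsClosed A) (hp : 0 < p) {γ κ : Measure (EOmega A)}
    [IsFiniteMeasure κ] (hγ : γ ∈ Opt p A (marginalFst A γ) (marginalSnd A γ))
    (hfin : totalCost p A γ ≠ ⊤) (hκ : κ ≤ γ) {π : Measure (X × X)} {μ ν : Measure X}
    (h₁ : IsPartialCoupling A (κ.map Subtype.val) μ ν) (h₂ : IsPartialCoupling A π μ ν) :
    totalCost p A κ ≤ ∫⁻ z, ecost p z ∂π := by
  have hsub : γ - κ + κ = γ := Measure.sub_add_cancel_of_le hκ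
  have hκ₁ := h₁.marginalFst_ofProd hA
  have hκ₂ := h₁.marginalSnd_ofProd hA
  rw [ofProd_map_val hA] at hκ₁ hκ₂
  have hmin := ((mem_opt_iff hp).1 hγ).2 (γ - κ + ofProd A π) ⟨by
    rw [marginalFst_add hA, h₂.marginalFst_ofProd hA, ← hκ₁, ← marginalFst_add hA, hsub], by
    rw [marginalSnd_add hA, h₂.marginalSnd_ofProd hA, ← hκ₂, ← marginalSnd_add hA, hsub]⟩
  have hrest : totalCost p A (γ - κ) ≠ ⊤ := by
    rw [← hsub, totalCost_add] at hfin
    exact (ENNReal.add_ne_top.1 hfin).1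
  rw [totalCost_add] at hmin
  nth_rewrite 1 [← hsub] at hmin
  rw [totalCost_add, ENNReal.add_le_add_iff_left hrest] at hmin
  exact hmin.trans (totalCost_ofProd_le hA π)

end Exchange

/-! ### Finiteness of the optimal cost -/

section Finite

variable {X : Type*} [MetricSpace X] [ProperSpace X] [MeasurableSpace X] [BorelSpace X]
  {p : ℝ} {A : Set X}

/-- A measurable approximate projection onto `A`. -/
theorem exists_measurable_approx_proj (hA' : A.Nonempty) :
    ∃ P : X → X, Measurable P ∧ (∀ x, P x ∈ A) ∧
      ∀ x, 0 < Metric.infDist x A → dist x (P x) ≤ 2 * Metric.infDist x A := by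
  classical
  have := hA'.to_subtype
  obtain ⟨a, ha⟩ := TopologicalSpace.exists_dense_seq A
  have hex : ∀ x : X, ∃ n : ℕ, 0 < Metric.infDist x A → dist x (a n) ≤ 2 * Metric.infDist x A := by
    intro x
    by_cases hx : 0 < Metric.infDist x A
    · obtain ⟨b, hb, hlt⟩ := (Metric.infDist_lt_iff hA').1
        (show Metric.infDist x A < 2 * Metric.infDist x A by linarith)
      obtain ⟨n, hn⟩ := ha.exists_dist_lt (⟨b, hb⟩ : A) (sub_pos.2 hlt)
      refine ⟨n, fun _ => (dist_triangle x b (a n)).trans ?_⟩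
      have : dist b (a n : X) < 2 * Metric.infDist x A - dist x b := hn
      linarith
    · exact ⟨0, fun h => absurd h hx⟩
  have hd : Measurable fun x : X => Metric.infDist x A :=
    (Metric.continuous_infDist_pt A).measurable
  have hfind : Measurable fun x => Nat.find (hex x) := by
    refine measurable_find hex fun n => ?_
    have : {x : X | 0 < Metric.infDist x A → dist x (a n) ≤ 2 * Metric.infDist x A} =
        {x | 0 < Metric.infDist x A}ᶜ ∪ {x | dist x (a n) ≤ 2 * Metric.infDist x A} := by
      ext x
      exact imp_iff_not_or
    rw [this]
    exact (measurableSet_lt measurable_const hd).compl.union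
      (measurableSet_le (continuous_id.dist continuous_const).measurable (hd.const_mul 2))
  exact ⟨fun x => a (Nat.find (hex x)), (measurable_of_countable fun n : ℕ => (a n : X)).comp hfind,
    fun x => (a _).2, fun x => Nat.find_spec (hex x)⟩

/-- Sending all mass approximately to the nearest points of `A` has finite cost, hence so has
every optimal plan. -/
theorem totalCost_ne_top_of_mem_opt (hA : IsClosed A) (hA' : A.Nonempty) (hp : 0 < p)
    {γ : Measure (EOmega A)} (hfin : ∫⁻ z, (einfDist p A z.1.1 + einfDist p A z.1.2) ∂γ ≠ ⊤)
    (hγ : γ ∈ Opt p A (marginalFst A γ) (marginalSnd A γ)) : totalCost p A γ ≠ ⊤ := by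
  obtain ⟨P, hP, hPA, hPd⟩ := exists_measurable_approx_proj hA'
  have hΩ : MeasurableSet Aᶜ := hA.measurableSet.compl
  set μ := γ.map fun z => z.1.1 with hμ
  set ν := γ.map fun z => z.1.2 with hν
  have hf : Measurable fun x : X => (x, P x) := measurable_id.prodMk hP
  have hg : Measurable fun y : X => (P y, y) := hP.prodMk measurable_id
  have hc : Measurable (ecost p : X × X → ℝ≥0∞) := (continuous_cost hp.le).measurable.ennreal_ofReal
  have hd := measurable_einfDist (A := A) hp.le
  set π := (μ.restrict Aᶜ).map (fun x => (x, P x)) + (ν.restrict Aᶜ).map (fun y => (P y, y))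
  have hπ : IsPartialCoupling A π μ ν := by
    constructor
    · intro T hT hTA
      have h₁ : (fun x : X => (x, P x)) ⁻¹' (Prod.fst ⁻¹' T) = T := rfl
      have h₂ : (fun y : X => (P y, y)) ⁻¹' (Prod.fst ⁻¹' T) = ∅ :=
        Set.eq_empty_of_forall_notMem fun y hy => Set.disjoint_left.1 hTA hy (hPA y)
      rw [Measure.add_apply, Measure.map_apply hf (measurable_fst hT),
        Measure.map_apply hg (measurable_fst hT), h₁, h₂, measure_empty, add_zero,
        Measure.restrict_apply hT, Set.inter_eq_left.2 hTA.subset_compl_right]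
    · intro T hT hTA
      have h₁ : (fun x : X => (x, P x)) ⁻¹' (Prod.snd ⁻¹' T) = ∅ :=
        Set.eq_empty_of_forall_notMem fun y hy => Set.disjoint_left.1 hTA hy (hPA y)
      have h₂ : (fun y : X => (P y, y)) ⁻¹' (Prod.snd ⁻¹' T) = T := rfl
      rw [Measure.add_apply, Measure.map_apply hf (measurable_snd hT),
        Measure.map_apply hg (measurable_snd hT), h₁, h₂, measure_empty, zero_add,
        Measure.restrict_apply hT, Set.inter_eq_left.2 hTA.subset_compl_right]
  have hle : ∀ x ∈ Aᶜ, ecost p (x, P x) ≤ ENNReal.ofReal (2 ^ p) * einfDist p A x := by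
    intro x hx
    rw [einfDist, ← ENNReal.ofReal_mul (by positivity),
      ← Real.mul_rpow zero_le_two Metric.infDist_nonneg]
    exact ENNReal.ofReal_le_ofReal (Real.rpow_le_rpow dist_nonneg
      (hPd x ((hA.notMem_iff_infDist_pos hA').1 hx)) hp.le)
  have hpart : ∀ f : EOmega A → X, Measurable f →
      ∫⁻ x in Aᶜ, ecost p (x, P x) ∂(γ.map f) ≤
        ENNReal.ofReal (2 ^ p) * ∫⁻ z, einfDist p A (f z) ∂γ := by
    intro f hfm
    calc ∫⁻ x in Aᶜ, ecost p (x, P x) ∂(γ.map f)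
        ≤ ∫⁻ x in Aᶜ, ENNReal.ofReal (2 ^ p) * einfDist p A x ∂(γ.map f) :=
          setLIntegral_mono (hd.const_mul _) hle
      _ ≤ ∫⁻ x, ENNReal.ofReal (2 ^ p) * einfDist p A x ∂(γ.map f) :=
          setLIntegral_le_lintegral _ _
      _ = _ := by rw [lintegral_const_mul _ hd, lintegral_map hd hfm]
  have hsymm : ∀ y, ecost p (P y, y) = ecost p (y, P y) := fun y => by
    rw [ecost, ecost, cost_comm]
  have hfin₁ : ∫⁻ z, einfDist p A z.1.1 ∂γ ≠ ⊤ :=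
    ne_top_of_le_ne_top hfin (lintegral_mono fun z => le_self_add)
  have hfin₂ : ∫⁻ z, einfDist p A z.1.2 ∂γ ≠ ⊤ :=
    ne_top_of_le_ne_top hfin (lintegral_mono fun z => le_add_self)
  have hcost : ∫⁻ z, ecost p z ∂π ≠ ⊤ := by
    rw [lintegral_add_measure, lintegral_map hc hf, lintegral_map hc hg]
    simp only [hsymm]
    exact ENNReal.add_ne_top.2
      ⟨ne_top_of_le_ne_top (ENNReal.mul_ne_top ENNReal.ofReal_ne_top hfin₁)
        (hpart _ measurable_fst_EOmega),
      ne_top_of_le_ne_top (ENNReal.mul_ne_top ENNReal.ofReal_ne_top hfin₂)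
        (hpart _ measurable_snd_EOmega)⟩
  have hadm : ofProd A π ∈ Adm A (marginalFst A γ) (marginalSnd A γ) :=
    ⟨hπ.marginalFst_ofProd hA, hπ.marginalSnd_ofProd hA⟩
  exact ne_top_of_le_ne_top hcost
    ((((mem_opt_iff hp).1 hγ).2 _ hadm).trans (totalCost_ofProd_le hA π))

end Finite

/-! ### Optimality implies cyclical monotonicity -/

section Cyclical

variable {X : Type*} [MetricSpace X] [ProperSpace X] [MeasurableSpace X] [BorelSpace X]
  {p : ℝ} {A : Set X}

/-- Probability measures concentrated near `u` and `w` can be coupled away from `A` at a cost close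
to `c̃(u, w)`: by their product if `c̃(u, w) = c(u, w)`, and otherwise by sending both to points of
`A` nearest to `u` and to `w`. -/
theorem exists_isPartialCoupling_cost_le (hA : IsClosed A) (hA' : A.Nonempty) (hp : 0 ≤ p)
    (u w : X) {δ : ℝ} (hδ : 0 < δ) :
    ∃ r > 0, ∀ μ ν : Measure X, IsProbabilityMeasure μ → IsProbabilityMeasure ν →
      μ (Metric.ball u r)ᶜ = 0 → ν (Metric.ball w r)ᶜ = 0 →
      ∃ π, IsPartialCoupling A π μ ν ∧
        ∫⁻ z, ecost p z ∂π ≤ ENNReal.ofReal (costTilde p A u w) + ENNReal.ofReal δ := by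
  have hc : Measurable (ecost p : X × X → ℝ≥0∞) := (continuous_cost hp).measurable.ennreal_ofReal
  rw [← ENNReal.ofReal_add (costTilde_nonneg u w) hδ.le]
  rcases le_total (cost p u w) (Metric.infDist u A ^ p + Metric.infDist w A ^ p) with hle | hle
  · obtain ⟨r, hr, hball⟩ := exists_ball_abs_cost_sub_lt hp u w hδ
    refine ⟨r, hr, fun μ ν _ _ hμ hν => ⟨μ.prod ν, ⟨fun T hT _ => ?_, fun T hT _ => ?_⟩, ?_⟩⟩
    · rw [← Measure.map_apply measurable_fst hT, Measure.map_fst_prod, measure_univ, one_smul]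
    · rw [← Measure.map_apply measurable_snd hT, Measure.map_snd_prod, measure_univ, one_smul]
    · calc ∫⁻ z, ecost p z ∂(μ.prod ν)
          ≤ ∫⁻ _, ENNReal.ofReal (costTilde p A u w + δ) ∂(μ.prod ν) := by
            apply lintegral_mono_ae
            have h₁ : ∀ᵐ z ∂(μ.prod ν), z.1 ∈ Metric.ball u r :=
              Measure.quasiMeasurePreserving_fst.ae (mem_ae_iff.2 hμ)
            have h₂ : ∀ᵐ z ∂(μ.prod ν), z.2 ∈ Metric.ball w r :=
              Measure.quasiMeasurePreserving_snd.ae (mem_ae_iff.2 hν)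
            filter_upwards [h₁, h₂] with z hz₁ hz₂
            refine ENNReal.ofReal_le_ofReal ?_
            have : costTilde p A u w = cost p u w := min_eq_left hle
            linarith [(abs_lt.1 (hball _ hz₁ _ hz₂)).2]
        _ = _ := by simp
  · obtain ⟨a, ha, hua⟩ := hA.exists_infDist_eq_dist hA' u
    obtain ⟨b, hb, hwb⟩ := hA.exists_infDist_eq_dist hA' w
    obtain ⟨r₁, hr₁, hball₁⟩ := exists_ball_abs_cost_sub_lt hp u a (half_pos hδ)
    obtain ⟨r₂, hr₂, hball₂⟩ := exists_ball_abs_cost_sub_lt hp b w (half_pos hδ)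
    have hf : Measurable fun x : X => (x, a) := by fun_prop
    have hg : Measurable fun y : X => (b, y) := by fun_prop
    refine ⟨min r₁ r₂, lt_min hr₁ hr₂, fun μ ν _ _ hμ hν =>
      ⟨μ.map (fun x => (x, a)) + ν.map (fun y => (b, y)),
        ⟨fun T hT hTA => ?_, fun T hT hTA => ?_⟩, ?_⟩⟩
    · have h₂ : (fun y : X => (b, y)) ⁻¹' (Prod.fst ⁻¹' T) = ∅ :=
        Set.eq_empty_of_forall_notMem fun y hy => Set.disjoint_left.1 hTA hy hb
      rw [Measure.add_apply, Measure.map_apply hf (measurable_fst hT),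
        Measure.map_apply hg (measurable_fst hT), h₂, measure_empty, add_zero]
      rfl
    · have h₁ : (fun x : X => (x, a)) ⁻¹' (Prod.snd ⁻¹' T) = ∅ :=
        Set.eq_empty_of_forall_notMem fun y hy => Set.disjoint_left.1 hTA hy ha
      rw [Measure.add_apply, Measure.map_apply hf (measurable_snd hT),
        Measure.map_apply hg (measurable_snd hT), h₁, measure_empty, zero_add]
      rfl
    · have hD : costTilde p A u w + δ = (cost p u a + δ / 2) + (cost p b w + δ / 2) := by
        have : costTilde p A u w = Metric.infDist u A ^ p + Metric.infDist w A ^ p :=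
          min_eq_right hle
        rw [this, hua, hwb, cost, cost, dist_comm w b]
        ring
      rw [lintegral_add_measure, lintegral_map hc hf, lintegral_map hc hg, hD,
        ENNReal.ofReal_add (add_nonneg (cost_nonneg _ _) (half_pos hδ).le)
          (add_nonneg (cost_nonneg _ _) (half_pos hδ).le)]
      refine add_le_add ?_ ?_
      · calc ∫⁻ x, ecost p (x, a) ∂μ ≤ ∫⁻ _, ENNReal.ofReal (cost p u a + δ / 2) ∂μ := by
              apply lintegral_mono_ae
              filter_upwards [mem_ae_iff.2 hμ] with x hx
              refine ENNReal.ofReal_le_ofReal ?_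
              have := hball₁ x (Metric.ball_subset_ball (min_le_left _ _) hx) a
                (Metric.mem_ball_self hr₁)
              linarith [(abs_lt.1 this).2]
          _ = _ := by simp
      · calc ∫⁻ y, ecost p (b, y) ∂ν ≤ ∫⁻ _, ENNReal.ofReal (cost p b w + δ / 2) ∂ν := by
              apply lintegral_mono_ae
              filter_upwards [mem_ae_iff.2 hν] with y hy
              refine ENNReal.ofReal_le_ofReal ?_
              have := hball₂ b (Metric.mem_ball_self hr₂) y
                (Metric.ball_subset_ball (min_le_right _ _) hy)
              linarith [(abs_lt.1 this).2]
          _ = _ := by simp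

/-- Near a point of the support of `γ` there is a normalized piece `κ` of `γ`, whose cost is almost
`c(z)`. At a point of `A × A` the marginals are Dirac masses, which need no transport, and `κ = 0`.
-/
theorem exists_local_part (hp : 0 ≤ p) (γ : Measure (EOmega A))
    [IsLocallyFiniteMeasure γ] {z : X × X} (hz : z ∈ supp A γ ∪ A ×ˢ A) {δ r : ℝ} (hδ : 0 < δ)
    (hr : 0 < r) :
    ∃ (κ : Measure (EOmega A)) (μ ν : Measure X) (M : ℝ≥0∞), IsFiniteMeasure κ ∧
      IsProbabilityMeasure μ ∧ IsProbabilityMeasure ν ∧ M ≠ ⊤ ∧ κ ≤ M • γ ∧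
      IsPartialCoupling A (κ.map Subtype.val) μ ν ∧
      μ (Metric.ball z.1 r)ᶜ = 0 ∧ ν (Metric.ball z.2 r)ᶜ = 0 ∧
      ENNReal.ofReal ((EOmega A).indicator (fun z => cost p z.1 z.2) z) ≤
        totalCost p A κ + ENNReal.ofReal δ := by
  by_cases hzA : z ∈ A ×ˢ A
  · refine ⟨0, Measure.dirac z.1, Measure.dirac z.2, 0, inferInstance, inferInstance,
      inferInstance, ENNReal.zero_ne_top, by simp, ⟨fun T hT hTA => ?_, fun T hT hTA => ?_⟩,
      ?_, ?_, ?_⟩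
    · simp [Measure.dirac_apply' _ hT, Set.disjoint_right.1 hTA hzA.1]
    · simp [Measure.dirac_apply' _ hT, Set.disjoint_right.1 hTA hzA.2]
    · simp [Measure.dirac_apply' _ Metric.isOpen_ball.measurableSet.compl, hr]
    · simp [Measure.dirac_apply' _ Metric.isOpen_ball.measurableSet.compl, hr]
    · simp [EOmega, hzA]
  · obtain ⟨z, hzs, rfl⟩ := hz.resolve_right hzA
    obtain ⟨r₁, hr₁, hball⟩ := exists_ball_abs_cost_sub_lt hp z.1.1 z.1.2 hδ
    obtain ⟨s, hs, hγs⟩ := γ.finiteAt_nhds z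
    obtain ⟨r₂, hr₂, hsub⟩ := Metric.mem_nhds_iff.1 hs
    set B := Metric.ball z (min r (min r₁ r₂)) with hB
    have hrad : 0 < min r (min r₁ r₂) := lt_min hr (lt_min hr₁ hr₂)
    have hBm : MeasurableSet B := Metric.isOpen_ball.measurableSet
    have hBpos : γ B ≠ 0 :=
      ((Measure.mem_support_iff_forall z).1 hzs B (Metric.ball_mem_nhds z hrad)).ne'
    have hBfin : γ B ≠ ⊤ := by
      refine ne_top_of_le_ne_top hγs.ne (measure_mono (subset_trans ?_ hsub))
      exact Metric.ball_subset_ball ((min_le_right _ _).trans (min_le_right _ _))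
    have hB₁ : ∀ z' ∈ B, z'.1.1 ∈ Metric.ball z.1.1 (min r (min r₁ r₂)) := fun z' hz' =>
      Metric.mem_ball.2 ((le_max_left _ _).trans_lt (Metric.mem_ball.1 hz'))
    have hB₂ : ∀ z' ∈ B, z'.1.2 ∈ Metric.ball z.1.2 (min r (min r₁ r₂)) := fun z' hz' =>
      Metric.mem_ball.2 ((le_max_right _ _).trans_lt (Metric.mem_ball.1 hz'))
    set κ := (γ B)⁻¹ • γ.restrict B with hκ
    have hκp : IsProbabilityMeasure κ :=
      ⟨by simp [hκ, ENNReal.inv_mul_cancel hBpos hBfin]⟩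
    have hae : ∀ᵐ z' ∂κ, z' ∈ B := Measure.ae_smul_measure (ae_restrict_mem hBm) _
    have hsubr : ∀ x : X, Metric.ball x (min r (min r₁ r₂)) ⊆ Metric.ball x r := fun x =>
      Metric.ball_subset_ball (min_le_left _ _)
    have hsubr₁ : ∀ x : X, Metric.ball x (min r (min r₁ r₂)) ⊆ Metric.ball x r₁ := fun x =>
      Metric.ball_subset_ball ((min_le_right _ _).trans (min_le_left _ _))
    refine ⟨κ, κ.map (fun z => z.1.1), κ.map (fun z => z.1.2), (γ B)⁻¹, inferInstance,
      Measure.isProbabilityMeasure_map measurable_fst_EOmega.aemeasurable,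
      Measure.isProbabilityMeasure_map measurable_snd_EOmega.aemeasurable,
      ENNReal.inv_ne_top.2 hBpos, ?_, ⟨fun T hT _ => ?_, fun T hT _ => ?_⟩, ?_, ?_, ?_⟩
    · intro t
      simp only [hκ, Measure.smul_apply, smul_eq_mul]
      exact mul_le_mul_right (Measure.restrict_apply_le _ _) _
    · rw [Measure.map_apply measurable_subtype_coe (measurable_fst hT),
        Measure.map_apply measurable_fst_EOmega hT]
      rfl
    · rw [Measure.map_apply measurable_subtype_coe (measurable_snd hT),
        Measure.map_apply measurable_snd_EOmega hT]
      rfl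
    · rw [Measure.map_apply measurable_fst_EOmega Metric.isOpen_ball.measurableSet.compl]
      exact mem_ae_iff.1 (hae.mono fun z' hz' => hsubr _ (hB₁ z' hz'))
    · rw [Measure.map_apply measurable_snd_EOmega Metric.isOpen_ball.measurableSet.compl]
      exact mem_ae_iff.1 (hae.mono fun z' hz' => hsubr _ (hB₂ z' hz'))
    · rw [Set.indicator_of_mem z.2]
      calc ENNReal.ofReal (cost p z.1.1 z.1.2)
          = ∫⁻ _, ENNReal.ofReal (cost p z.1.1 z.1.2) ∂κ := by simp
        _ ≤ ∫⁻ z', (ecost p z'.1 + ENNReal.ofReal δ) ∂κ := by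
            apply lintegral_mono_ae
            filter_upwards [hae] with z' hz'
            rw [ecost, ← ENNReal.ofReal_add (cost_nonneg _ _) hδ.le]
            refine ENNReal.ofReal_le_ofReal ?_
            linarith [(abs_lt.1 (hball _ (hsubr₁ _ (hB₁ z' hz')) _ (hsubr₁ _ (hB₂ z' hz')))).1]
        _ = totalCost p A κ + ENNReal.ofReal δ := by
            rw [lintegral_add_right _ measurable_const]
            simp [totalCost, ecost, cost]

/-- The key inequality for an optimal plan. On the left, points of the support count with the cost
`c` and points of `A × A` count nothing; on the right, the cost is `c̃`. -/
theorem sum_cost_le_sum_costTilde (hA : IsClosed A) (hA' : A.Nonempty) (hp : 0 < p)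
    {γ : Measure (EOmega A)} [IsLocallyFiniteMeasure γ]
    (hγ : γ ∈ Opt p A (marginalFst A γ) (marginalSnd A γ)) (hfin : totalCost p A γ ≠ ⊤)
    {n : ℕ} (x y : Fin n → X) (hxy : ∀ i, (x i, y i) ∈ supp A γ ∪ A ×ˢ A)
    (σ : Equiv.Perm (Fin n)) :
    ∑ i, (EOmega A).indicator (fun z => cost p z.1 z.2) (x i, y i) ≤
      ∑ i, costTilde p A (x i) (y (σ i)) := by
  have hind : ∀ i, 0 ≤ (EOmega A).indicator (fun z => cost p z.1 z.2) (x i, y i) := fun i =>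
    Set.indicator_nonneg (fun z _ => cost_nonneg z.1 z.2) _
  -- Each index contributes an error `δ` from the piece removed and one from the coupling added.
  suffices h : ∀ δ : ℝ, 0 < δ →
      ∑ i, (EOmega A).indicator (fun z => cost p z.1 z.2) (x i, y i) ≤
        ∑ i, costTilde p A (x i) (y (σ i)) + (2 * n) * δ by
    have hlim : Tendsto (fun δ : ℝ => ∑ i, costTilde p A (x i) (y (σ i)) + (2 * n) * δ) (𝓝[>] 0)
        (𝓝 (∑ i, costTilde p A (x i) (y (σ i)) + (2 * n) * 0)) :=
      (Continuous.tendsto (by fun_prop) 0).mono_left nhdsWithin_le_nhds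
    rw [mul_zero, add_zero] at hlim
    exact ge_of_tendsto hlim (eventually_mem_nhdsWithin.mono fun δ hδ => h δ hδ)
  intro δ hδ
  choose r₀ hr₀ hcoup using fun i =>
    exists_isPartialCoupling_cost_le hA hA' hp.le (x i) (y (σ i)) hδ
  obtain ⟨r, hr, hrle⟩ : ∃ r > 0, ∀ i, r ≤ r₀ i := by
    have h : ∀ᶠ r in 𝓝[>] (0 : ℝ), ∀ i, r ≤ r₀ i := eventually_all.2 fun i =>
      mem_of_superset (Ioc_mem_nhdsGT (hr₀ i)) fun r hr => hr.2
    obtain ⟨r, hr, h⟩ := (h.and eventually_mem_nhdsWithin).exists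
    exact ⟨r, h, hr⟩
  choose κ μ ν M hκ hμ hν hM hle hκc hμb hνb hcost using fun i =>
    exists_local_part hp.le γ (hxy i) hδ hr
  have hballs : ∀ u : X, ∀ i, (Metric.ball u (r₀ i))ᶜ ⊆ (Metric.ball u r)ᶜ := fun u i =>
    Set.compl_subset_compl.2 (Metric.ball_subset_ball (hrle i))
  choose π hπ hπc using fun i => hcoup i (μ i) (ν (σ i)) (hμ i) (hν (σ i))
    (measure_mono_null (hballs _ i) (hμb i)) (measure_mono_null (hballs _ i) (hνb (σ i)))
  -- The pieces are scaled by `t` so that their sum is a part of `γ`.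
  set N : ℝ≥0∞ := ∑ i, M i + 1 with hN
  have hN0 : N ≠ 0 := by simp [hN]
  have hNtop : N ≠ ⊤ :=
    ENNReal.add_ne_top.2 ⟨ENNReal.sum_ne_top.2 fun i _ => hM i, ENNReal.one_ne_top⟩
  have ht0 : N⁻¹ ≠ 0 := ENNReal.inv_ne_zero.2 hNtop
  have httop : N⁻¹ ≠ ⊤ := ENNReal.inv_ne_top.2 hN0
  have hκle : N⁻¹ • ∑ i, κ i ≤ γ := by
    intro s
    rw [Measure.smul_apply, Measure.finsetSum_apply, smul_eq_mul,
      ENNReal.inv_mul_le_iff hN0 hNtop]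
    calc ∑ i, κ i s ≤ ∑ i, M i * γ s := Finset.sum_le_sum fun i _ => hle i s
      _ = (∑ i, M i) * γ s := (Finset.sum_mul _ _ _).symm
      _ ≤ N * γ s := mul_le_mul_left le_self_add _
  have hκfin : IsFiniteMeasure (N⁻¹ • ∑ i, κ i) := by
    refine ⟨?_⟩
    rw [Measure.smul_apply, Measure.finsetSum_apply, smul_eq_mul]
    exact ENNReal.mul_lt_top httop.lt_top (ENNReal.sum_lt_top.2 fun i _ => measure_lt_top _ _)
  have hsumν : ∑ i, ν (σ i) = ∑ i, ν i := Equiv.sum_comp σ ν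
  have hmap : (N⁻¹ • ∑ i, κ i).map Subtype.val = N⁻¹ • ∑ i, (κ i).map Subtype.val := by
    ext s hs
    simp only [Measure.map_apply measurable_subtype_coe hs, Measure.smul_apply,
      Measure.finsetSum_apply]
  have hex := totalCost_le_of_mem_opt hA hp hγ hfin hκle
    (by rw [hmap]; exact (IsPartialCoupling.sum hκc).smul N⁻¹)
    (by rw [← hsumν]; exact (IsPartialCoupling.sum hπ).smul N⁻¹)
  have hsum : ∑ i, totalCost p A (κ i) ≤ ∑ i, ∫⁻ z, ecost p z ∂(π i) := by
    rw [totalCost, lintegral_smul_measure, lintegral_smul_measure, lintegral_finsetSum_measure,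
      lintegral_finsetSum_measure, smul_eq_mul, smul_eq_mul,
      ENNReal.mul_le_mul_iff_right ht0 httop] at hex
    exact hex
  have hfinal : ∑ i, ENNReal.ofReal
      ((EOmega A).indicator (fun z => cost p z.1 z.2) (x i, y i)) ≤
      ∑ i, ENNReal.ofReal (costTilde p A (x i) (y (σ i)) + 2 * δ) := by
    calc _ ≤ ∑ i, (totalCost p A (κ i) + ENNReal.ofReal δ) :=
          Finset.sum_le_sum fun i _ => hcost i
      _ ≤ ∑ i, (∫⁻ z, ecost p z ∂(π i) + ENNReal.ofReal δ) := by
          rw [Finset.sum_add_distrib, Finset.sum_add_distrib]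
          exact add_le_add_left hsum _
      _ ≤ _ := Finset.sum_le_sum fun i _ => by
          refine (add_le_add_left (hπc i) _).trans_eq ?_
          rw [← ENNReal.ofReal_add (costTilde_nonneg _ _) hδ.le,
            ← ENNReal.ofReal_add (add_nonneg (costTilde_nonneg _ _) hδ.le) hδ.le]
          congr 1
          ring
  have hnn : ∀ i, 0 ≤ costTilde p A (x i) (y (σ i)) + 2 * δ := fun i =>
    add_nonneg (costTilde_nonneg _ _) (by positivity)
  rw [← ENNReal.ofReal_sum_of_nonneg fun i _ => hind i,
    ← ENNReal.ofReal_sum_of_nonneg fun i _ => hnn i,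
    ENNReal.ofReal_le_ofReal_iff (Finset.sum_nonneg fun i _ => hnn i)] at hfinal
  refine hfinal.trans_eq ?_
  rw [Finset.sum_add_distrib, Finset.sum_const, Finset.card_univ, Fintype.card_fin, nsmul_eq_mul]
  ring

variable {γ : Measure (EOmega A)} [IsLocallyFiniteMeasure γ]

/-- The case of a single pair in the key inequality. -/
theorem supp_subset_setS_of_mem_opt (hA : IsClosed A) (hA' : A.Nonempty) (hp : 0 < p)
    (hγ : γ ∈ Opt p A (marginalFst A γ) (marginalSnd A γ)) (hfin : totalCost p A γ ≠ ⊤) :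
    supp A γ ⊆ setS p A := by
  rintro z hz
  have hzE : z ∈ EOmega A := by obtain ⟨z, -, rfl⟩ := hz; exact z.2
  have h := sum_cost_le_sum_costTilde hA hA' hp hγ hfin (n := 1) (fun _ => z.1) (fun _ => z.2)
    (fun _ => Or.inl hz) 1
  simp only [Fin.sum_univ_one, Set.indicator_of_mem hzE] at h
  exact le_antisymm (costTilde_le_cost _ _) h

theorem cyclicallyMonotone_of_mem_opt (hA : IsClosed A) (hA' : A.Nonempty) (hp : 0 < p)
    (hγ : γ ∈ Opt p A (marginalFst A γ) (marginalSnd A γ)) (hfin : totalCost p A γ ≠ ⊤) :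
    CyclicallyMonotone (costTilde p A) (supp A γ ∪ A ×ˢ A) := by
  intro n x y hxy σ
  refine (Finset.sum_le_sum fun i _ => ?_).trans
    (sum_cost_le_sum_costTilde hA hA' hp hγ hfin x y hxy σ)
  by_cases hi : (x i, y i) ∈ A ×ˢ A
  · rw [costTilde_eq_zero hp hi.1 hi.2]
    exact Set.indicator_nonneg (fun z _ => cost_nonneg z.1 z.2) _
  · rw [Set.indicator_of_mem hi]
    exact costTilde_le_cost _ _

end Cyclical

/-! ### Supports -/

section Support

variable {X : Type*} [MetricSpace X] [MeasurableSpace X] {A : Set X}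
  {γ : Measure (EOmega A)} {T : Set (X × X)}

theorem supp_subset_of_concentratedOn (hT : IsClosed T) (h : ConcentratedOn γ T) :
    supp A γ ⊆ T := by
  rintro _ ⟨z, hz, rfl⟩
  by_contra hzT
  have hnhds : (Subtype.val ⁻¹' Tᶜ : Set (EOmega A)) ∈ 𝓝 z :=
    (hT.isOpen_compl.preimage continuous_subtype_val).mem_nhds hzT
  exact ((Measure.mem_support_iff_forall z).1 hz _ hnhds).ne' h

theorem concentratedOn_of_supp_subset [ProperSpace X] (h : supp A γ ⊆ T) : ConcentratedOn γ T :=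
  measure_mono_null (fun _ hz hs => hz (h ⟨_, hs, rfl⟩))
    (mem_ae_iff.1 (Measure.support_mem_ae (μ := γ)))

end Support

end PartialOT

theorem mainTheorem4 {X : Type*} [MetricSpace X] [ProperSpace X] [MeasurableSpace X] [BorelSpace X]
    (A : Set X) (hA : IsClosed A) (hA' : A.Nonempty) (p : ℝ) (hp : 1 ≤ p)
    (γ : Measure (PartialOT.EOmega A)) (hγ : PartialOT.IsRadon γ)
    (hfin : ∫⁻ z, ENNReal.ofReal
      (Metric.infDist z.1.1 A ^ p + Metric.infDist z.1.2 A ^ p) ∂γ < ⊤) :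
    List.TFAE [
      γ ∈ PartialOT.Opt p A (PartialOT.marginalFst A γ) (PartialOT.marginalSnd A γ),
      PartialOT.ConcentratedOn γ (PartialOT.setS p A) ∧
        PartialOT.CyclicallyMonotone (PartialOT.costTilde p A) (PartialOT.supp A γ ∪ A ×ˢ A),
      ∃ φ : X → EReal, PartialOT.CConcave (PartialOT.cost p) φ ∧
        (∀ a ∈ A, φ a = 0 ∧ PartialOT.cTransform (PartialOT.cost p) φ a = 0) ∧
        PartialOT.supp A γ ⊆ PartialOT.cSuperdifferential (PartialOT.cost p) φ] ∧
    (γ ∈ PartialOT.Opt p A (PartialOT.marginalFst A γ) (PartialOT.marginalSnd A γ) →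
      (∀ᵐ z ∂(PartialOT.restrictTo γ (PartialOT.Omega A) A),
        dist z.1.1 z.1.2 = Metric.infDist z.1.1 A) ∧
      (∀ᵐ z ∂(PartialOT.restrictTo γ A (PartialOT.Omega A)),
        dist z.1.1 z.1.2 = Metric.infDist z.1.2 A)) := by
  open PartialOT in
  have hp0 : 0 < p := zero_lt_one.trans_le hp
  have hAm : MeasurableSet A := hA.measurableSet
  have : LocallyCompactSpace (EOmega A) :=
    ((hA.prod hA).isOpen_compl.isOpenEmbedding_subtypeVal).locallyCompactSpace
  have : IsFiniteMeasureOnCompacts γ := hγ.1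
  have : IsLocallyFiniteMeasure γ := isLocallyFiniteMeasure_of_isFiniteMeasureOnCompacts
  have hfin' : ∫⁻ z, (einfDist p A z.1.1 + einfDist p A z.1.2) ∂γ ≠ ⊤ := by
    simpa only [ofReal_infDist_add] using hfin.ne
  have hS : γ ∈ Opt p A (marginalFst A γ) (marginalSnd A γ) → supp A γ ⊆ setS p A := fun h =>
    supp_subset_setS_of_mem_opt hA hA' hp0 h (totalCost_ne_top_of_mem_opt hA hA' hp0 hfin' h)
  refine ⟨?_, fun h => ⟨?_, ?_⟩⟩
  · tfae_have 1 → 2 := fun h => ⟨concentratedOn_of_supp_subset (hS h),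
      cyclicallyMonotone_of_mem_opt hA hA' hp0 h (totalCost_ne_top_of_mem_opt hA hA' hp0 hfin' h)⟩
    tfae_have 2 → 3 := fun h => exists_cConcave_of_cyclicallyMonotone hA hA' hp0
      (supp_subset_of_concentratedOn (isClosed_setS hp0.le) h.1) h.2
    tfae_have 3 → 1 := fun ⟨φ, hφ, h0, hsupp⟩ => mem_opt_of_supp_subset hA hA' hp0 hfin' hφ h0 hsupp
    tfae_finish
  · have hm : MeasurableSet (Subtype.val ⁻¹' (Omega A ×ˢ A) : Set (EOmega A)) :=
      measurable_subtype_coe (hAm.compl.prod hAm)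
    filter_upwards [ae_restrict_of_ae (Measure.support_mem_ae (μ := γ)), ae_restrict_mem hm]
      with z hz hzm
    exact dist_eq_infDist_of_mem_setS_right hp0 hzm.2 (hS h ⟨z, hz, rfl⟩)
  · have hm : MeasurableSet (Subtype.val ⁻¹' (A ×ˢ Omega A) : Set (EOmega A)) :=
      measurable_subtype_coe (hAm.prod hAm.compl)
    filter_upwards [ae_restrict_of_ae (Measure.support_mem_ae (μ := γ)), ae_restrict_mem hm]
      with z hz hzm
    rw [dist_comm]
    exact dist_eq_infDist_of_mem_setS_right hp0 hzm.1 (swap_mem_setS (hS h ⟨z, hz, rfl⟩))
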